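/- Let $G$ be a finite simple graph and let $k\ge 1$ be an integer. A matching is a set of pairwise disjoint edges, and for a set $F$ of edges of $G$ let $\nu(F)$ denote the maximum size of a matching contained in $F$. Let $E_1,\dots,E_{3k-2}$ be non-empty sets of edges of $G$ (not necessarily disjoint or distinct) such that $\nu(E_i\cup E_j)\ge k$ for all $i\ne j$. Then $E=\bigcup_i E_i$ has a rainbow matching of size $k$; that is, there is a matching $M\subseteq E$ with $|M|=k$ together with an injective map $c\colon M\to\{1,\dots,3k-2\}$ such that $e\in E_{c(e)}$ for every $e\in M$. -/

import Mathlib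

/-- A set of edges is a matching if its edges are pairwise disjoint
(two distinct members have no common end). -/
def IsEdgeMatching {V : Type*} (M : Set (Sym2 V)) : Prop :=
  M.Pairwise fun e f => ∀ v : V, v ∈ e → v ∉ f

/-- The matching number of an edge set: the largest size of a matching contained in it
(an extended natural number, so that no finiteness is needed for it to be meaningful). -/
noncomputable def matchingNumber {V : Type*} (F : Set (Sym2 V)) : ℕ∞ :=
  ⨆ M ∈ {M : Set (Sym2 V) | M ⊆ F ∧ IsEdgeMatching M}, M.encard

/-- `M` is a rainbow matching of the family `E` of edge sets: it is a matching contained in the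
union of the family, and its edges can be chosen from members of `E` with distinct indices. -/
def IsRainbowMatching {V ι : Type*} (E : ι → Set (Sym2 V)) (M : Set (Sym2 V)) : Prop :=
  IsEdgeMatching M ∧ M ⊆ ⋃ i, E i ∧
    ∃ c : M → ι, Function.Injective c ∧ ∀ e : M, (e : Sym2 V) ∈ E (c e)

/-! Grow a rainbow matching M of size m < k one edge at a time, and suppose that no rainbow matching
of size m + 1 exists. At least 2m + 1 colours are unused by M. Adding to M one edge from each of
several unused colours keeps the matching number at m, since every matching in the resulting graph
is rainbow. What can grow is the set D of vertices missed by some maximum matching: it starts with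
at least n - 2m of the n vertices and never exceeds n.

Call an edge useless if adding it changes neither the matching number nor D. By Gallai–Edmonds
theory, useless edges remain useless together (`card_le_of_isUseless`). Two colours have a matching
of size m + 1 in their union, so at most one colour is useless throughout. Hence useful edges can be
spent colour by colour. In `exists_choices` this is done so that every unspent colour of the pool
keeps a useful edge: if spending e ruins a colour l, then e enlarged D by one vertex only (else
`false_of_slack`), and by `swap` an edge of l can be spent instead. Since D has room for at most 2m
such steps, some unused colour j is useless throughout over M, and its edges lie inside V(M).

Spending 2m other unused colours makes D everything. So for an edge ab of colour j there is a
rainbow matching A of size m, without colour j, covering V(M) - a + w for some w. If A misses b,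
then ab extends it. Otherwise replacing the edge of A at b by ab gives a rainbow matching M' of size
m that uses j. Some colour j' unused by M' is useless over M', so E_j ∪ E_j' lies on the 2m + 1
vertices V(M) + w, too few for a matching of size m + 1. -/

/-- A finite set of pairwise disjoint non-loop edges. -/
def IsFinMatching {V : Type*} (N : Finset (Sym2 V)) : Prop :=
  (∀ e ∈ N, ¬ e.IsDiag) ∧ ∀ e ∈ N, ∀ f ∈ N, ∀ v, v ∈ e → v ∈ f → e = f

/-- The vertices covered by a finite set of edges. -/
def coveredVerts {V : Type*} [DecidableEq V] (N : Finset (Sym2 V)) : Finset V :=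
  N.biUnion Sym2.toFinset

theorem IsFinMatching.ne {V : Type*} {N : Finset (Sym2 V)} (hN : IsFinMatching N) {u v : V}
    (h : s(u, v) ∈ N) : u ≠ v := fun e => hN.1 _ h (by simp [e])

theorem IsFinMatching.subset {V : Type*} {N N' : Finset (Sym2 V)} (hN : IsFinMatching N) (h : N' ⊆ N) :
    IsFinMatching N' :=
  ⟨fun e he => hN.1 e (h he), fun e he f hf => hN.2 e (h he) f (h hf)⟩

/-! ### Covered vertices, parity and alternating paths -/

section Matchings

variable {V : Type*} [DecidableEq V]

theorem mem_coveredVerts {N : Finset (Sym2 V)} {v : V} :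
    v ∈ coveredVerts N ↔ ∃ e ∈ N, v ∈ e := by
  simp [coveredVerts]

theorem exists_edge_of_mem_coveredVerts {N : Finset (Sym2 V)} {v : V} (h : v ∈ coveredVerts N) :
    ∃ u, s(v, u) ∈ N := by
  obtain ⟨e, he, hv⟩ := mem_coveredVerts.1 h
  obtain ⟨u, rfl⟩ := Sym2.mem_iff_exists.1 hv
  exact ⟨u, he⟩

theorem left_mem_coveredVerts {N : Finset (Sym2 V)} {u v : V} (h : s(u, v) ∈ N) :
    u ∈ coveredVerts N := mem_coveredVerts.2 ⟨_, h, by simp⟩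

theorem right_mem_coveredVerts {N : Finset (Sym2 V)} {u v : V} (h : s(u, v) ∈ N) :
    v ∈ coveredVerts N := mem_coveredVerts.2 ⟨_, h, by simp⟩

theorem coveredVerts_insert {N : Finset (Sym2 V)} {u v x : V} :
    x ∈ coveredVerts (insert s(u, v) N) ↔ x = u ∨ x = v ∨ x ∈ coveredVerts N := by
  simp [mem_coveredVerts, or_assoc]

theorem IsFinMatching.insert_edge {N : Finset (Sym2 V)} (hN : IsFinMatching N) {u v : V} (huv : u ≠ v)
    (hu : u ∉ coveredVerts N) (hv : v ∉ coveredVerts N) : IsFinMatching (insert s(u, v) N) := by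
  have key : ∀ e ∈ N, ∀ x, x ∈ e → x ∈ s(u, v) → False := by
    intro e he x hx hx'
    rcases Sym2.mem_iff.1 hx' with rfl | rfl
    · exact hu (mem_coveredVerts.2 ⟨e, he, hx⟩)
    · exact hv (mem_coveredVerts.2 ⟨e, he, hx⟩)
  constructor
  · intro e he
    rcases Finset.mem_insert.1 he with rfl | he
    · simpa using huv
    · exact hN.1 e he
  · intro e he f hf x hxe hxf
    rcases Finset.mem_insert.1 he with rfl | he <;> rcases Finset.mem_insert.1 hf with rfl | hf
    · rfl
    · exact (key f hf x hxf hxe).elim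
    · exact (key e he x hxe hxf).elim
    · exact hN.2 e he f hf x hxe hxf

theorem card_insert_edge {N : Finset (Sym2 V)} {u v : V} (hu : u ∉ coveredVerts N) :
    (insert s(u, v) N).card = N.card + 1 :=
  Finset.card_insert_of_notMem fun h => hu (left_mem_coveredVerts h)

theorem IsFinMatching.coveredVerts_erase {N : Finset (Sym2 V)} (hN : IsFinMatching N) {u v x : V}
    (h : s(u, v) ∈ N) :
    x ∈ coveredVerts (N.erase s(u, v)) ↔ x ∈ coveredVerts N ∧ x ≠ u ∧ x ≠ v := by
  simp only [mem_coveredVerts, Finset.mem_erase]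
  constructor
  · rintro ⟨e, ⟨hne, he⟩, hx⟩
    refine ⟨⟨e, he, hx⟩, ?_, ?_⟩
    · rintro rfl; exact hne (hN.2 _ he _ h x hx (by simp))
    · rintro rfl; exact hne (hN.2 _ he _ h x hx (by simp))
  · rintro ⟨⟨e, he, hx⟩, h1, h2⟩
    refine ⟨e, ⟨?_, he⟩, hx⟩
    rintro rfl
    rcases Sym2.mem_iff.1 hx with rfl | rfl
    · exact h1 rfl
    · exact h2 rfl

theorem IsFinMatching.card_coveredVerts {N : Finset (Sym2 V)} (hN : IsFinMatching N) :
    (coveredVerts N).card = 2 * N.card := by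
  unfold coveredVerts
  rw [Finset.card_biUnion]
  · rw [Finset.sum_congr rfl (fun e he => Sym2.card_toFinset_of_not_isDiag e (hN.1 e he))]
    simp [mul_comm]
  · intro e he f hf hef
    refine Finset.disjoint_left.2 fun x hx hx' => ?_
    exact hef (hN.2 e he f hf x (by simpa using hx) (by simpa using hx'))

theorem IsFinMatching.two_mul_card_le {N : Finset (Sym2 V)} (hN : IsFinMatching N) {W : Finset V}
    (h : ∀ e ∈ N, ∀ v ∈ e, v ∈ W) : 2 * N.card ≤ W.card := by
  rw [← hN.card_coveredVerts]
  refine Finset.card_le_card fun v hv => ?_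
  obtain ⟨e, he, hve⟩ := mem_coveredVerts.1 hv
  exact h e he v hve

/-- No edge of `N` leaves `K`, so the covered part of `K` is a union of whole edges. -/
theorem IsFinMatching.even_card_inter {N : Finset (Sym2 V)} (hN : IsFinMatching N) {K : Finset V}
    (hK : ∀ u v, s(u, v) ∈ N → u ∈ K → v ∈ K) : Even (K ∩ coveredVerts N).card := by
  classical
  have : K ∩ coveredVerts N = coveredVerts (N.filter fun e => ∃ v ∈ e, v ∈ K) := by
    ext x
    simp only [Finset.mem_inter, mem_coveredVerts, Finset.mem_filter]
    constructor
    · rintro ⟨hx, e, he, hxe⟩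
      exact ⟨e, ⟨he, x, hxe, hx⟩, hxe⟩
    · rintro ⟨e, ⟨he, v, hve, hv⟩, hxe⟩
      refine ⟨?_, e, he, hxe⟩
      obtain ⟨u, rfl⟩ := Sym2.mem_iff_exists.1 hve
      rcases Sym2.mem_iff.1 hxe with rfl | rfl
      · exact hv
      · exact hK _ _ he hv
  rw [this, (hN.subset (Finset.filter_subset _ _)).card_coveredVerts]
  exact even_two_mul _

/-- Exchange along the component of the symmetric difference that starts at `v`: this path either
ends at a vertex `w` covered only by `N₂`, or at a vertex `w` covered only by `N₁`. -/
theorem IsFinMatching.exchange {N₁ N₂ : Finset (Sym2 V)} (h₁ : IsFinMatching N₁)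
    (h₂ : IsFinMatching N₂) {v : V} (hv₁ : v ∈ coveredVerts N₁) (hv₂ : v ∉ coveredVerts N₂) :
    ∃ w N₁' N₂', w ≠ v ∧ IsFinMatching N₁' ∧ IsFinMatching N₂' ∧ N₁' ⊆ N₁ ∪ N₂ ∧ N₂' ⊆ N₁ ∪ N₂ ∧
      ((w ∈ coveredVerts N₂ ∧ w ∉ coveredVerts N₁ ∧
          (∀ x, x ∈ coveredVerts N₁' ↔ (x ∈ coveredVerts N₁ ∧ x ≠ v) ∨ x = w) ∧
          (∀ x, x ∈ coveredVerts N₂' ↔ (x ∈ coveredVerts N₂ ∧ x ≠ w) ∨ x = v) ∧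
          N₁'.card = N₁.card ∧ N₂'.card = N₂.card) ∨
        (w ∈ coveredVerts N₁ ∧ w ∉ coveredVerts N₂ ∧
          (∀ x, x ∈ coveredVerts N₁' ↔ x ∈ coveredVerts N₁ ∧ x ≠ v ∧ x ≠ w) ∧
          (∀ x, x ∈ coveredVerts N₂' ↔ x ∈ coveredVerts N₂ ∨ x = v ∨ x = w) ∧
          N₁'.card + 1 = N₁.card ∧ N₂'.card = N₂.card + 1)) := by
  induction hn : N₁.card using Nat.strong_induction_on generalizing N₁ N₂ v with
  | _ n ih =>
  -- Walk along vu in `N₁` and uz in `N₂`. If the path goes on, delete both edges, recurse from z,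
  -- and put them back with their roles exchanged.
  obtain ⟨u, hvu⟩ := exists_edge_of_mem_coveredVerts hv₁
  have hne := h₁.ne hvu
  have hc₁ : (N₁.erase s(v, u)).card + 1 = N₁.card := Finset.card_erase_add_one hvu
  have e₁ : ∀ x, x ∈ coveredVerts (N₁.erase s(v, u)) ↔ x ∈ coveredVerts N₁ ∧ x ≠ v ∧ x ≠ u :=
    fun x => h₁.coveredVerts_erase hvu
  have m₁ := h₁.subset (Finset.erase_subset s(v, u) N₁)
  by_cases hu : u ∈ coveredVerts N₂
  · obtain ⟨z, huz⟩ := exists_edge_of_mem_coveredVerts hu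
    have hne' := h₂.ne huz
    have hz₂ := right_mem_coveredVerts huz
    have hzv : z ≠ v := fun e => hv₂ (e ▸ hz₂)
    have hc₂ : (N₂.erase s(u, z)).card + 1 = N₂.card := Finset.card_erase_add_one huz
    have e₂ : ∀ x, x ∈ coveredVerts (N₂.erase s(u, z)) ↔ x ∈ coveredVerts N₂ ∧ x ≠ u ∧ x ≠ z :=
      fun x => h₂.coveredVerts_erase huz
    have m₂ := h₂.subset (Finset.erase_subset s(u, z) N₂)
    have hsub : N₁.erase s(v, u) ∪ N₂.erase s(u, z) ⊆ N₁ ∪ N₂ :=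
      Finset.union_subset_union (Finset.erase_subset _ _) (Finset.erase_subset _ _)
    have hin₁ : s(u, z) ∈ N₁ ∪ N₂ := Finset.mem_union_right _ huz
    have hin₂ : s(v, u) ∈ N₁ ∪ N₂ := Finset.mem_union_left _ hvu
    by_cases hz : z ∈ coveredVerts N₁
    · obtain ⟨w, A, B, hwz, hA, hB, hAs, hBs, H⟩ :=
        ih _ (by omega) m₁ m₂ (v := z) (by rw [e₁]; exact ⟨hz, hzv, hne'.symm⟩)
          (by rw [e₂]; simp) rfl
      have hu₁ := right_mem_coveredVerts hvu
      rcases H with ⟨hw1, hw2, hAx, hBx, hAc, hBc⟩ | ⟨hw1, hw2, hAx, hBx, hAc, hBc⟩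
      · have hwv : w ≠ v := by rintro rfl; rw [e₂] at hw1; exact hv₂ hw1.1
        have hwu : w ≠ u := by rintro rfl; rw [e₂] at hw1; exact hw1.2.1 rfl
        have uA : u ∉ coveredVerts A := by simp [hAx, e₁, hwu.symm]
        have zA : z ∉ coveredVerts A := by simp [hAx, e₁, hwz.symm]
        have uB : u ∉ coveredVerts B := by simp [hBx, e₂, hne']
        have vB : v ∉ coveredVerts B := by simp [hBx, e₂, hv₂, hzv.symm]
        refine ⟨w, insert s(u, z) A, insert s(v, u) B, hwv, hA.insert_edge hne' uA zA,
          hB.insert_edge hne vB uB, Finset.insert_subset hin₁ (hAs.trans hsub),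
          Finset.insert_subset hin₂ (hBs.trans hsub), Or.inl ⟨?_, ?_, ?_, ?_, ?_, ?_⟩⟩
        · exact ((e₂ w).1 hw1).1
        · exact fun h => hw2 ((e₁ w).2 ⟨h, hwv, hwu⟩)
        · intro x; rw [coveredVerts_insert, hAx, e₁]; clear ih hAx hBx e₁ e₂ hsub hAs hBs; grind
        · intro x; rw [coveredVerts_insert, hBx, e₂]; clear ih hAx hBx e₁ e₂ hsub hAs hBs; grind
        · rw [card_insert_edge uA]; omega
        · rw [card_insert_edge vB]; omega
      · rw [e₁] at hw1
        have uA : u ∉ coveredVerts A := by simp [hAx, e₁]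
        have zA : z ∉ coveredVerts A := by simp [hAx]
        have uB : u ∉ coveredVerts B := by simp [hBx, e₂, hne', hw1.2.2.symm]
        have vB : v ∉ coveredVerts B := by simp [hBx, e₂, hv₂, hzv.symm, hw1.2.1.symm]
        refine ⟨w, insert s(u, z) A, insert s(v, u) B, hw1.2.1, hA.insert_edge hne' uA zA,
          hB.insert_edge hne vB uB, Finset.insert_subset hin₁ (hAs.trans hsub),
          Finset.insert_subset hin₂ (hBs.trans hsub), Or.inr ⟨hw1.1, ?_, ?_, ?_, ?_, ?_⟩⟩
        · exact fun h => hw2 ((e₂ w).2 ⟨h, hw1.2.2, hwz⟩)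
        · intro x; rw [coveredVerts_insert, hAx, e₁]; clear ih hAx hBx e₁ e₂ hsub hAs hBs; grind
        · intro x; rw [coveredVerts_insert, hBx, e₂]; clear ih hAx hBx e₁ e₂ hsub hAs hBs; grind
        · rw [card_insert_edge uA]; omega
        · rw [card_insert_edge vB]; omega
    · have uA : u ∉ coveredVerts (N₁.erase s(v, u)) := by rw [e₁]; simp
      have zA : z ∉ coveredVerts (N₁.erase s(v, u)) := by rw [e₁]; grind
      have uB : u ∉ coveredVerts (N₂.erase s(u, z)) := by rw [e₂]; simp
      have vB : v ∉ coveredVerts (N₂.erase s(u, z)) := by rw [e₂]; grind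
      refine ⟨z, insert s(u, z) (N₁.erase s(v, u)), insert s(v, u) (N₂.erase s(u, z)), hzv,
        m₁.insert_edge hne' uA zA, m₂.insert_edge hne vB uB,
        Finset.insert_subset hin₁ (Finset.subset_union_left.trans hsub),
        Finset.insert_subset hin₂ (Finset.subset_union_right.trans hsub),
        Or.inl ⟨hz₂, hz, ?_, ?_, ?_, ?_⟩⟩
      · intro x; rw [coveredVerts_insert, e₁]
        have := right_mem_coveredVerts hvu
        grind
      · intro x; rw [coveredVerts_insert, e₂]; grind
      · rw [card_insert_edge uA]; omega
      · rw [card_insert_edge vB]; omega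
  · refine ⟨u, N₁.erase s(v, u), insert s(v, u) N₂, hne.symm, m₁, h₂.insert_edge hne hv₂ hu,
      (Finset.erase_subset _ _).trans Finset.subset_union_left,
      Finset.insert_subset (Finset.mem_union_left _ hvu) Finset.subset_union_right,
      Or.inr ⟨right_mem_coveredVerts hvu, hu, e₁, ?_, by omega, card_insert_edge hv₂⟩⟩
    intro x; rw [coveredVerts_insert]; grind

end Matchings

/-! ### Gallai–Edmonds theory: missed vertices, stability, Gallai's lemma -/

/-- `N` is a matching of size `m` contained in the edge set `G`. -/
def IsMatchingIn {V : Type*} (G : Set (Sym2 V)) (m : ℕ) (N : Finset (Sym2 V)) : Prop :=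
  IsFinMatching N ∧ (N : Set (Sym2 V)) ⊆ G ∧ N.card = m

/-- The maximum size of a finite matching contained in the edge set `G` is `m`. -/
def HasMatchingNumber {V : Type*} (G : Set (Sym2 V)) (m : ℕ) : Prop :=
  (∃ N, IsMatchingIn G m N) ∧
    ∀ N : Finset (Sym2 V), IsFinMatching N → (N : Set (Sym2 V)) ⊆ G → N.card ≤ m

/-- The vertices missed by some matching of size `m` in `G`. -/
def missedVerts {V : Type*} [DecidableEq V] (G : Set (Sym2 V)) (m : ℕ) : Set V :=
  {v | ∃ N, IsMatchingIn G m N ∧ v ∉ coveredVerts N}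

/-- The edges of `G` that avoid the vertex set `S`. -/
def avoidEdges {V : Type*} (G : Set (Sym2 V)) (S : Finset V) : Set (Sym2 V) :=
  {e ∈ G | ∀ v ∈ S, v ∉ e}

/-- Adding the edge `e` to `G` changes neither the matching number `m` nor the set of vertices
missed by maximum matchings. -/
def IsUseless {V : Type*} [DecidableEq V] (G : Set (Sym2 V)) (m : ℕ) (e : Sym2 V) : Prop :=
  HasMatchingNumber (insert e G) m ∧ missedVerts (insert e G) m = missedVerts G m

section GallaiEdmonds

variable {V : Type*} [DecidableEq V]

theorem IsMatchingIn.mono {V : Type*} {G G' : Set (Sym2 V)} {m : ℕ} {N : Finset (Sym2 V)}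
    (h : IsMatchingIn G m N) (hG : G ⊆ G') : IsMatchingIn G' m N :=
  ⟨h.1, h.2.1.trans hG, h.2.2⟩

theorem missedVerts_mono {G G' : Set (Sym2 V)} (hG : G ⊆ G') (m : ℕ) :
    missedVerts G m ⊆ missedVerts G' m :=
  fun _ ⟨N, hN, hv⟩ => ⟨N, hN.mono hG, hv⟩

theorem HasMatchingNumber.of_subset {V : Type*} {G G₁ G' : Set (Sym2 V)} {m : ℕ}
    (h : HasMatchingNumber G m) (h' : HasMatchingNumber G' m) (hG : G ⊆ G₁) (hG' : G₁ ⊆ G') :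
    HasMatchingNumber G₁ m :=
  ⟨let ⟨N, hN⟩ := h.1; ⟨N, hN.mono hG⟩, fun N hN hs => h'.2 N hN (hs.trans hG')⟩

theorem notMem_of_notMem_coveredVerts {N : Finset (Sym2 V)} {a : V} (ha : a ∉ coveredVerts N)
    {e : Sym2 V} (he : e ∈ N) : a ∉ e := fun h => ha (mem_coveredVerts.2 ⟨e, he, h⟩)

theorem IsMatchingIn.erase_vertex {G : Set (Sym2 V)} {k : ℕ} {N : Finset (Sym2 V)} {a : V}
    (h : IsMatchingIn G (k + 1) N) (ha : a ∈ coveredVerts N) :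
    ∃ N', IsMatchingIn (avoidEdges G {a}) k N' ∧ coveredVerts N' ⊆ coveredVerts N := by
  obtain ⟨u, hau⟩ := exists_edge_of_mem_coveredVerts ha
  refine ⟨N.erase s(a, u), ⟨h.1.subset (Finset.erase_subset _ _), ?_, ?_⟩, ?_⟩
  · intro e he
    refine ⟨h.2.1 (Finset.erase_subset _ _ he), fun v hv => ?_⟩
    rw [Finset.mem_singleton] at hv
    subst hv
    refine notMem_of_notMem_coveredVerts ?_ he
    rw [h.1.coveredVerts_erase hau]
    simp
  · have := Finset.card_erase_add_one hau
    have := h.2.2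
    omega
  · intro x hx
    exact ((h.1.coveredVerts_erase hau).1 hx).1

theorem IsMatchingIn.insert_edge {G : Set (Sym2 V)} {m : ℕ} {N : Finset (Sym2 V)} {u v : V}
    (h : IsMatchingIn G m N) (huv : u ≠ v) (hu : u ∉ coveredVerts N) (hv : v ∉ coveredVerts N) :
    IsMatchingIn (insert s(u, v) G) (m + 1) (insert s(u, v) N) :=
  ⟨h.1.insert_edge huv hu hv, by
    rw [Finset.coe_insert]; exact Set.insert_subset_insert h.2.1, by
    rw [card_insert_edge hu, h.2.2]⟩

theorem IsMatchingIn.mem_of_notMem_missedVerts {G : Set (Sym2 V)} {m : ℕ} {N : Finset (Sym2 V)}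
    {v : V} (hN : IsMatchingIn G m N) (hv : v ∉ missedVerts G m) : v ∈ coveredVerts N := by
  by_contra h
  exact hv ⟨N, hN, h⟩

theorem avoid_edge_vertex {G : Set (Sym2 V)} {N : Finset (Sym2 V)} {S : Finset V}
    (h : (N : Set (Sym2 V)) ⊆ avoidEdges G S) {v : V} (hv : v ∈ S) : v ∉ coveredVerts N := by
  intro hc
  obtain ⟨e, he, hve⟩ := mem_coveredVerts.1 hc
  exact (h he).2 v hv hve

theorem avoidEdges_subset {V : Type*} {G : Set (Sym2 V)} {S : Finset V} : avoidEdges G S ⊆ G :=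
  fun _ h => h.1

/-- Gallai's stability lemma for the removal of one vertex. -/
theorem HasMatchingNumber.avoid_singleton {G : Set (Sym2 V)} {k : ℕ}
    (hG : HasMatchingNumber G (k + 1)) {a x : V} (ha : a ∉ missedVerts G (k + 1))
    (hx : x ∈ missedVerts G (k + 1)) (hxa : s(x, a) ∈ G) :
    HasMatchingNumber (avoidEdges G {a}) k ∧
      ∀ v, v ≠ a → (v ∈ missedVerts (avoidEdges G {a}) k ↔ v ∈ missedVerts G (k + 1)) := by
  have cov : ∀ N, IsMatchingIn G (k + 1) N → a ∈ coveredVerts N := fun N hN =>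
    IsMatchingIn.mem_of_notMem_missedVerts hN ha
  refine ⟨⟨?_, ?_⟩, ?_⟩
  · obtain ⟨N, hN⟩ := hG.1
    obtain ⟨N', hN', -⟩ := hN.erase_vertex (cov N hN)
    exact ⟨N', hN'⟩
  · intro N hN hs
    by_contra hc
    have h1 := hG.2 N hN (hs.trans avoidEdges_subset)
    exact avoid_edge_vertex hs (Finset.mem_singleton_self a)
      (cov N ⟨hN, hs.trans avoidEdges_subset, by omega⟩)
  · intro v hva
    constructor
    · rintro ⟨N', hN', hv⟩
      by_contra hvD
      obtain ⟨N, hN, hxN⟩ := hx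
      have hvN := IsMatchingIn.mem_of_notMem_missedVerts hN hvD
      have hNG : ((N ∪ N' : Finset (Sym2 V)) : Set (Sym2 V)) ⊆ G := by
        rw [Finset.coe_union]
        exact Set.union_subset hN.2.1 (hN'.2.1.trans avoidEdges_subset)
      have haN' : a ∉ coveredVerts N' :=
        avoid_edge_vertex hN'.2.1 (Finset.mem_singleton_self a)
      obtain ⟨w, A, B, hwv, hA, hB, hAs, hBs, H⟩ := hN.1.exchange hN'.1 hvN hv
      have hAG : (A : Set (Sym2 V)) ⊆ G := (Finset.coe_subset.2 hAs).trans hNG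
      have hBG : (B : Set (Sym2 V)) ⊆ G := (Finset.coe_subset.2 hBs).trans hNG
      -- In the first case `A` is maximum and misses v. In the second, if the path ends at a, then
      -- `A` plus the edge xa is maximum and misses v; otherwise `B` is a maximum matching missing
      -- a.
      rcases H with ⟨hw1, hw2, hAx, hBx, hAc, hBc⟩ | ⟨hw1, hw2, hAx, hBx, hAc, hBc⟩
      · exact hvD ⟨A, ⟨hA, hAG, hAc.trans hN.2.2⟩, by simp [hAx, hwv.symm]⟩
      · by_cases hwa : w = a
        · subst hwa
          have hxv : x ≠ v := by rintro rfl; exact hxN hvN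
          have hxw : x ≠ w := by rintro rfl; exact hxN hw1
          have hm : IsMatchingIn G k A := ⟨hA, hAG, by have := hN.2.2; omega⟩
          have := hm.insert_edge hxw (by simp [hAx, hxN]) (by simp [hAx])
          rw [Set.insert_eq_of_mem hxa] at this
          refine hvD ⟨_, this, ?_⟩
          simp [coveredVerts_insert, hAx, hxv.symm, hva]
        · have := cov B ⟨hB, hBG, by have := hN'.2.2; omega⟩
          rw [hBx] at this
          rcases this with h | h | h
          · exact haN' h
          · exact hva h.symm
          · exact hwa h.symm
    · rintro ⟨N, hN, hv⟩
      obtain ⟨N', hN', hs⟩ := hN.erase_vertex (cov N hN)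
      exact ⟨N', hN', fun h => hv (hs h)⟩

/-- Gallai's stability lemma: removing neighbours of missed vertices that are not themselves
missed lowers the matching number by one each and keeps the missed vertices. -/
theorem HasMatchingNumber.avoid {G : Set (Sym2 V)} {m : ℕ} (hG : HasMatchingNumber G m)
    (S : Finset V) (hS : ∀ a ∈ S, a ∉ missedVerts G m ∧ ∃ x ∈ missedVerts G m, s(x, a) ∈ G) :
    ∃ k, k + S.card = m ∧ HasMatchingNumber (avoidEdges G S) k ∧
      ∀ v ∉ S, (v ∈ missedVerts (avoidEdges G S) k ↔ v ∈ missedVerts G m) := by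
  induction S using Finset.induction_on with
  | empty =>
    have : avoidEdges G ∅ = G := by ext; simp [avoidEdges]
    exact ⟨m, by simp, by rwa [this], by simp [this]⟩
  | insert a S haS ih =>
    obtain ⟨k, hk, hGk, hD⟩ := ih fun b hb => hS b (Finset.mem_insert_of_mem hb)
    obtain ⟨haD, x, hxD, hxa⟩ := hS a (Finset.mem_insert_self a S)
    have hxS : x ∉ S := fun h => (hS x (Finset.mem_insert_of_mem h)).1 hxD
    have haD' : a ∉ missedVerts (avoidEdges G S) k := by rwa [hD a haS]
    have hxD' : x ∈ missedVerts (avoidEdges G S) k := by rwa [hD x hxS]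
    have hxa' : s(x, a) ∈ avoidEdges G S := by
      refine ⟨hxa, fun v hv h => ?_⟩
      rcases Sym2.mem_iff.1 h with rfl | rfl
      · exact hxS hv
      · exact haS hv
    obtain ⟨k', rfl⟩ : ∃ k', k = k' + 1 := by
      obtain ⟨N, hN⟩ := hGk.1
      have h1 := IsMatchingIn.mem_of_notMem_missedVerts hN haD'
      obtain ⟨u, hu⟩ := exists_edge_of_mem_coveredVerts h1
      have := Finset.card_pos.2 ⟨_, hu⟩
      have := hN.2.2
      exact ⟨k - 1, by omega⟩
    have heq : avoidEdges G (insert a S) = avoidEdges (avoidEdges G S) {a} := by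
      ext e
      simp only [avoidEdges, Set.mem_ofPred_eq, Finset.mem_insert, Finset.mem_singleton]
      constructor
      · rintro ⟨h1, h2⟩
        exact ⟨⟨h1, fun v hv => h2 v (Or.inr hv)⟩, fun v hv => h2 v (Or.inl hv)⟩
      · rintro ⟨⟨h1, h2⟩, h3⟩
        exact ⟨h1, fun v hv => hv.elim (h3 v) (h2 v)⟩
    obtain ⟨h1, h2⟩ := hGk.avoid_singleton haD' hxD' hxa'
    refine ⟨k', by rw [Finset.card_insert_of_notMem haS]; omega, heq ▸ h1, fun v hv => ?_⟩
    rw [Finset.mem_insert, not_or] at hv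
    rw [heq, h2 v hv.1, hD v hv.2]

/-- Gallai's lemma: "no maximum matching misses both vertices" is a transitive relation on the
vertices missed by some maximum matching. -/
theorem HasMatchingNumber.gallai_trans {G : Set (Sym2 V)} {m : ℕ} (hG : HasMatchingNumber G m)
    {u v w : V} (hv : v ∈ missedVerts G m) (huw : u ≠ w)
    (huv : ∀ N, IsMatchingIn G m N → u ∈ coveredVerts N ∨ v ∈ coveredVerts N)
    (hvw : ∀ N, IsMatchingIn G m N → v ∈ coveredVerts N ∨ w ∈ coveredVerts N) :
    ∀ N, IsMatchingIn G m N → u ∈ coveredVerts N ∨ w ∈ coveredVerts N := by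
  intro N hN
  by_contra hc
  rw [not_or] at hc
  have hvN := (huv N hN).resolve_left hc.1
  obtain ⟨N', hN', hvN'⟩ := hv
  have hNG : ((N ∪ N' : Finset (Sym2 V)) : Set (Sym2 V)) ⊆ G := by
    rw [Finset.coe_union]
    exact Set.union_subset hN.2.1 hN'.2.1
  obtain ⟨z, A, B, hzv, hA, hB, hAs, hBs, H⟩ := hN.1.exchange hN'.1 hvN hvN'
  have hAG : (A : Set (Sym2 V)) ⊆ G := (Finset.coe_subset.2 hAs).trans hNG
  have hBG : (B : Set (Sym2 V)) ⊆ G := (Finset.coe_subset.2 hBs).trans hNG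
  rcases H with ⟨hw1, hw2, hAx, hBx, hAc, hBc⟩ | ⟨hw1, hw2, hAx, hBx, hAc, hBc⟩
  -- As `A` misses v it must cover both u and w, but z is its only newly covered vertex.
  · have hAm : IsMatchingIn G m A := ⟨hA, hAG, hAc.trans hN.2.2⟩
    have hvA : v ∉ coveredVerts A := by simp [hAx, hzv.symm]
    have h1 := (huv A hAm).resolve_right hvA
    have h2 := (hvw A hAm).resolve_left hvA
    rw [hAx] at h1 h2
    have h1' := h1.resolve_left fun h => hc.1 h.1
    have h2' := h2.resolve_left fun h => hc.2 h.1
    exact huw (h1'.trans h2'.symm)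
  · have := hG.2 B hB hBG
    have := hN'.2.2
    omega

/-- A useless edge at a missed vertex either leads to a neighbour that is never missed, or joins
two missed vertices that are not simultaneously missed after deleting such neighbours. -/
theorem IsUseless.sim {G : Set (Sym2 V)} {m k : ℕ} {A : Finset V} {x y : V}
    (hA : ∀ a, a ∈ A ↔ a ∉ missedVerts G m ∧ ∃ z ∈ missedVerts G m, s(z, a) ∈ G)
    (hk : k + A.card = m) (hxy : x ≠ y) (he : IsUseless G m s(x, y)) (hx : x ∈ missedVerts G m)
    (hy : y ∉ A) :
    y ∈ missedVerts G m ∧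
      ∀ N, IsMatchingIn (avoidEdges G A) k N → x ∈ coveredVerts N ∨ y ∈ coveredVerts N := by
  have hxA : x ∉ A := fun h => ((hA x).1 h).1 hx
  -- Otherwise replace the edge yz of a maximum matching missing x by xy. This frees z, which was
  -- already missed in `G` by uselessness, so y would belong to `A`.
  have hyD : y ∈ missedVerts G m := by
    by_contra hyD
    obtain ⟨N, hN, hxN⟩ := hx
    obtain ⟨z, hyz⟩ := exists_edge_of_mem_coveredVerts (IsMatchingIn.mem_of_notMem_missedVerts hN hyD)
    have hzx : z ≠ x := by rintro rfl; exact hxN (right_mem_coveredVerts hyz)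
    have hzy := hN.1.ne hyz
    obtain ⟨k', rfl⟩ : ∃ k', m = k' + 1 := by
      have := Finset.card_pos.2 ⟨_, hyz⟩
      have := hN.2.2
      exact ⟨m - 1, by omega⟩
    have e := fun v => hN.1.coveredVerts_erase (x := v) hyz
    have hm : IsMatchingIn G k' (N.erase s(y, z)) := by
      refine ⟨hN.1.subset (Finset.erase_subset _ _), ?_, ?_⟩
      · exact (Finset.coe_subset.2 (Finset.erase_subset _ _)).trans hN.2.1
      · have := Finset.card_erase_add_one hyz
        have := hN.2.2
        omega
    have := hm.insert_edge hxy (by simp [e, hxN]) (by simp [e])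
    have hz : z ∈ missedVerts (insert s(x, y) G) (k' + 1) :=
      ⟨_, this, by simp [coveredVerts_insert, e, hzx, hzy.symm]⟩
    rw [he.2] at hz
    refine hy ((hA y).2 ⟨hyD, z, hz, ?_⟩)
    rw [Sym2.eq_swap]
    exact hN.2.1 hyz
  refine ⟨hyD, fun N hN => ?_⟩
  by_contra hc
  rw [not_or] at hc
  have hins := hN.insert_edge hxy hc.1 hc.2
  -- Stability applies to `G` with the useless edge added, because its missed vertices are the same.
  obtain ⟨k', hk', hG', -⟩ := he.1.avoid A (by
    intro a ha
    rw [he.2]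
    obtain ⟨h1, z, hz, hza⟩ := (hA a).1 ha
    exact ⟨h1, z, hz, Or.inr hza⟩)
  have hk'k : k' = k := by omega
  subst hk'k
  have := hG'.2 _ hins.1 (by
    refine hins.2.1.trans ?_
    rintro e (rfl | h)
    · refine ⟨Or.inl rfl, fun v hv h => ?_⟩
      rcases Sym2.mem_iff.1 h with rfl | rfl
      · exact hxA hv
      · exact hy hv
    · exact ⟨Or.inr h.1, h.2⟩)
  have := hins.2.2
  omega

theorem HasMatchingNumber.isUseless_of_mem {G : Set (Sym2 V)} {m : ℕ}
    (hG : HasMatchingNumber G m) {e : Sym2 V} (he : e ∈ G) : IsUseless G m e := by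
  rw [IsUseless, Set.insert_eq_of_mem he]
  exact ⟨hG, rfl⟩

end GallaiEdmonds

/-! ### Useless edges behave like a closure operator -/

section Closure

variable {V : Type*} [DecidableEq V] [Fintype V]

/-- A matching of useless edges is at most as large as a maximum matching, and it is smaller if
it misses a vertex that no maximum matching misses. -/
theorem HasMatchingNumber.card_le_of_isUseless {G : Set (Sym2 V)} {m : ℕ}
    (hG : HasMatchingNumber G m) {N : Finset (Sym2 V)} (hN : IsFinMatching N)
    (hu : ∀ e ∈ N, IsUseless G m e) :
    N.card ≤ m ∧ ∀ z ∉ missedVerts G m, z ∉ coveredVerts N → N.card < m := by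
  classical
  obtain ⟨A, hA⟩ : ∃ A : Finset V,
      ∀ a, a ∈ A ↔ a ∉ missedVerts G m ∧ ∃ z ∈ missedVerts G m, s(z, a) ∈ G :=
    ⟨Finset.univ.filter fun a => a ∉ missedVerts G m ∧ ∃ z ∈ missedVerts G m, s(z, a) ∈ G,
      by simp⟩
  obtain ⟨k, hk, hGA, hD⟩ := hG.avoid A fun a ha => (hA a).1 ha
  obtain ⟨P, hP⟩ := hGA.1
  let sim : V → V → Prop := fun u v =>
    ∀ N, IsMatchingIn (avoidEdges G A) k N → u ∈ coveredVerts N ∨ v ∈ coveredVerts N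
  have sim_symm : ∀ u v, sim u v → sim v u := fun u v h N hN => (h N hN).symm
  have disjA : ∀ v ∈ missedVerts G m, v ∉ A := fun v hv h => ((hA v).1 h).1 hv
  have sim_trans : ∀ u v w, v ∈ missedVerts G m → u ≠ w → sim u v → sim v w → sim u w :=
    fun u v w hv huw h1 h2 => hGA.gallai_trans ((hD v (disjA v hv)).2 hv) huw h1 h2
  -- These classes play the role of the Gallai–Edmonds components inside D. Useless edges avoiding
  -- `A` do not leave them.
  let K : V → Finset V := fun r => Finset.univ.filter fun u =>
    u ∈ missedVerts G m ∧ (u = r ∨ sim r u)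
  have hK : ∀ r u, u ∈ K r ↔ u ∈ missedVerts G m ∧ (u = r ∨ sim r u) := by simp [K]
  have closed : ∀ Q : Finset (Sym2 V), IsFinMatching Q → (∀ e ∈ Q, IsUseless G m e) →
      (∀ v ∈ A, v ∉ coveredVerts Q) → ∀ r, Even (K r ∩ coveredVerts Q).card := by
    intro Q hQ hQu hQA r
    refine hQ.even_card_inter fun u v huv hur => ?_
    rw [hK] at hur ⊢
    have hvA : v ∉ A := fun h => hQA v h (right_mem_coveredVerts huv)
    obtain ⟨h1, h2⟩ := (hQu _ huv).sim hA hk (hQ.ne huv) hur.1 hvA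
    refine ⟨h1, ?_⟩
    rcases hur.2 with rfl | h3
    · exact Or.inr h2
    · by_cases hvr : v = r
      · exact Or.inl hvr
      · exact Or.inr (sim_trans r u v hur.1 (Ne.symm hvr) h3 h2)
  have hPA : ∀ v ∈ A, v ∉ coveredVerts P := fun v hv => avoid_edge_vertex hP.2.1 hv
  have hPu : ∀ e ∈ P, IsUseless G m e := fun e he => by
    have : e ∈ G := (hP.2.1 he).1
    rw [IsUseless, Set.insert_eq_of_mem this]
    exact ⟨hG, rfl⟩
  let N' := N.filter fun e => ∀ v ∈ A, v ∉ e
  have hN' : IsFinMatching N' := hN.subset (Finset.filter_subset _ _)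
  have hN'A : ∀ v ∈ A, v ∉ coveredVerts N' := by
    intro v hv h
    obtain ⟨e, he, hve⟩ := mem_coveredVerts.1 h
    exact (Finset.mem_filter.1 he).2 v hv hve
  let R : Finset V := (A ∪ coveredVerts P)ᶜ
  let R' : Finset V := (A ∪ coveredVerts N')ᶜ
  have hR : ∀ r, r ∈ R ↔ r ∉ A ∧ r ∉ coveredVerts P := by simp [R]
  have hR' : ∀ r, r ∈ R' ↔ r ∉ A ∧ r ∉ coveredVerts N' := by simp [R']
  have hRD : ∀ r ∈ R, r ∈ missedVerts G m := fun r hr =>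
    (hD r ((hR r).1 hr).1).1 ⟨P, hP, ((hR r).1 hr).2⟩
  -- If `N'` covered all of `K r`, then `K r` would be even. But `P` covers all of it except r, so
  -- `K r` without r is even too.
  have hg : ∀ r ∈ R, ∃ u ∈ K r, u ∉ coveredVerts N' := by
    intro r hr
    by_contra hc
    push Not at hc
    have h1 := closed N' hN' (fun e he => hu e (Finset.mem_filter.1 he).1) hN'A r
    have h2 := closed P hP.1 hPu hPA r
    rw [Finset.inter_eq_left.2 hc] at h1
    have h3 : K r ∩ coveredVerts P = (K r).erase r := by
      ext u
      rw [Finset.mem_inter, Finset.mem_erase, and_comm]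
      refine and_congr_left fun hur => ⟨?_, fun hne => ?_⟩
      · rintro h rfl; exact ((hR u).1 hr).2 h
      · have := (((hK r u).1 hur).2.resolve_left hne) P hP
        exact this.resolve_left ((hR r).1 hr).2
    have h4 : r ∈ K r := (hK r r).2 ⟨hRD r hr, Or.inl rfl⟩
    rw [h3] at h2
    have h5 := Finset.card_erase_add_one h4
    rw [← h5, Nat.even_add_one] at h1
    exact h1 h2
  choose! g hgK hgN using hg
  have hginj : Set.InjOn g R := by
    intro r hr r' hr' hrr'
    by_contra hne
    have h1 := (hK _ _).1 (hgK r hr)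
    have h2 := (hK _ _).1 (hgK r' hr')
    rw [← hrr'] at h2
    have h3 : sim r r' := by
      rcases h1.2 with h | h <;> rcases h2.2 with h' | h'
      · exact (hne (h.symm.trans h')).elim
      · rw [h] at h'; exact sim_symm _ _ h'
      · rwa [h'] at h
      · exact sim_trans _ _ _ h1.1 hne h (sim_symm _ _ h')
    exact (h3 P hP).elim ((hR r).1 hr).2 ((hR r').1 hr').2
  have hgR' : R.image g ⊆ R' := by
    intro u hu'
    obtain ⟨r, hr, rfl⟩ := Finset.mem_image.1 hu'
    exact (hR' _).2 ⟨disjA _ ((hK _ _).1 (hgK r hr)).1, hgN r hr⟩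
  have hcard : (R.image g).card = R.card := Finset.card_image_of_injOn hginj
  have hcount : ∀ Q : Finset (Sym2 V), IsFinMatching Q → (∀ v ∈ A, v ∉ coveredVerts Q) →
      A.card + 2 * Q.card + ((A ∪ coveredVerts Q)ᶜ).card = Fintype.card V := by
    intro Q hQ hQA
    rw [← hQ.card_coveredVerts, ← Finset.card_union_of_disjoint (Finset.disjoint_left.2 hQA),
      Finset.card_add_card_compl]
  have c1 := hcount P hP.1 hPA
  have c2 := hcount N' hN' hN'A
  -- Disjoint edges that meet `A` meet it in distinct vertices.
  have c3 : (N.filter fun e => ¬ ∀ v ∈ A, v ∉ e).card ≤ (A ∩ coveredVerts N).card := by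
    have : ∀ e ∈ N.filter fun e => ¬ ∀ v ∈ A, v ∉ e, ∃ v ∈ A, v ∈ e := by
      intro e he
      have := (Finset.mem_filter.1 he).2
      push Not at this
      exact this
    obtain hV | hV := isEmpty_or_nonempty V
    · rw [Finset.eq_empty_of_isEmpty (N.filter _)]
      simp
    choose! f hfA hfe using this
    refine Finset.card_le_card_of_injOn f (fun e he => ?_) fun e he e' he' hee' => ?_
    · exact Finset.mem_inter.2 ⟨hfA e he, mem_coveredVerts.2
        ⟨e, (Finset.mem_filter.1 he).1, hfe e he⟩⟩
    · exact hN.2 e (Finset.mem_filter.1 he).1 e' (Finset.mem_filter.1 he').1 (f e) (hfe e he)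
        (hee' ▸ hfe e' he')
  have c4 : N'.card + (N.filter fun e => ¬ ∀ v ∈ A, v ∉ e).card = N.card :=
    Finset.card_filter_add_card_filter_not _
  have c5 : (A ∩ coveredVerts N).card ≤ A.card := Finset.card_le_card Finset.inter_subset_left
  have c6 : R.card ≤ R'.card := hcard ▸ Finset.card_le_card hgR'
  have c7 := hP.2.2
  change A.card + 2 * P.card + R.card = _ at c1
  change A.card + 2 * N'.card + R'.card = _ at c2
  -- For strictness: if z is in `A`, fewer than `A.card` edges meet `A`. Otherwise z is one more
  -- vertex missed by `N'`, distinct from every `g r` since those lie in D.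
  refine ⟨by omega, fun z hz hzN => ?_⟩
  by_cases hzA : z ∈ A
  · have : (A ∩ coveredVerts N).card < A.card := by
      refine Finset.card_lt_card ⟨Finset.inter_subset_left, fun h => hzN ?_⟩
      exact (Finset.mem_inter.1 (h hzA)).2
    omega
  · have : (R.image g).card < R'.card := by
      refine Finset.card_lt_card ⟨hgR', fun h => hz ?_⟩
      have hzR : z ∈ R' := by
        refine (hR' z).2 ⟨hzA, fun h' => hzN ?_⟩
        obtain ⟨e, he, hze⟩ := mem_coveredVerts.1 h'
        exact mem_coveredVerts.2 ⟨e, (Finset.mem_filter.1 he).1, hze⟩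
      obtain ⟨r, hr, rfl⟩ := Finset.mem_image.1 (h hzR)
      exact ((hK _ _).1 (hgK r hr)).1
    omega

/-- Useless edges stay useless together. -/
theorem HasMatchingNumber.of_forall_isUseless {G G' : Set (Sym2 V)} {m : ℕ}
    (hG : HasMatchingNumber G m) (hGG' : G ⊆ G') (hu : ∀ e ∈ G', IsUseless G m e) :
    HasMatchingNumber G' m ∧ missedVerts G' m = missedVerts G m := by
  have h := fun N (hN : IsFinMatching N) (hs : (N : Set (Sym2 V)) ⊆ G') =>
    hG.card_le_of_isUseless hN fun e he => hu e (hs he)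
  refine ⟨⟨let ⟨N, hN⟩ := hG.1; ⟨N, hN.mono hGG'⟩, fun N hN hs => (h N hN hs).1⟩, ?_⟩
  refine Set.Subset.antisymm ?_ (missedVerts_mono hGG' m)
  rintro v ⟨N, hN, hv⟩
  by_contra hc
  have := (h N hN.1 hN.2.1).2 v hc hv
  have := hN.2.2
  omega

/-- Adding a useless edge does not change which edges are useless. -/
theorem HasMatchingNumber.isUseless_insert_iff {G : Set (Sym2 V)} {m : ℕ}
    (hG : HasMatchingNumber G m) {e f : Sym2 V} (he : IsUseless G m e) :
    IsUseless (insert e G) m f ↔ IsUseless G m f := by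
  constructor
  · intro hf
    have h1 : insert f G ⊆ insert f (insert e G) :=
      Set.insert_subset_insert (Set.subset_insert _ _)
    refine ⟨hG.of_subset hf.1 (Set.subset_insert _ _) h1,
      Set.Subset.antisymm ?_ (missedVerts_mono (Set.subset_insert _ _) m)⟩
    rw [← he.2, ← hf.2]
    exact missedVerts_mono h1 m
  · intro hf
    have := hG.of_forall_isUseless (G' := insert f (insert e G))
      ((Set.subset_insert _ _).trans (Set.subset_insert _ _)) (by
        rintro g (rfl | rfl | hg)
        · exact hf
        · exact he
        · exact hG.isUseless_of_mem hg)
    exact ⟨this.1, this.2.trans he.2.symm⟩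

/-- If `e` is useful and adds just one missed vertex, and `f` is useful but becomes useless
after adding `e`, then `e` and `f` can be interchanged. -/
theorem HasMatchingNumber.swap {G : Set (Sym2 V)} {m : ℕ} (hG : HasMatchingNumber G m)
    {e f : Sym2 V} (heG : HasMatchingNumber (insert e G) m)
    (hcard : (missedVerts (insert e G) m).ncard ≤ (missedVerts G m).ncard + 1)
    (hf : ¬ IsUseless G m f) (hfe : IsUseless (insert e G) m f) :
    HasMatchingNumber (insert f G) m ∧
      missedVerts (insert f G) m = missedVerts (insert e G) m ∧
      ∀ g, IsUseless (insert f G) m g ↔ IsUseless (insert e G) m g := by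
  have hfG : HasMatchingNumber (insert f G) m :=
    hG.of_subset hfe.1 (Set.subset_insert _ _) (Set.insert_subset_insert (Set.subset_insert _ _))
  have h1 : missedVerts (insert f G) m ⊆ missedVerts (insert e G) m := by
    rw [← hfe.2]
    exact missedVerts_mono (Set.insert_subset_insert (Set.subset_insert _ _)) m
  -- D grows strictly with `f` and stays inside the set obtained with `e`, which has at most one
  -- extra vertex; so the two sets agree.
  have h2 : missedVerts G m ⊂ missedVerts (insert f G) m :=
    (missedVerts_mono (Set.subset_insert _ _) m).ssubset_of_ne fun h => hf ⟨hfG, h.symm⟩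
  have h3 := Set.ncard_lt_ncard h2
  have h4 : missedVerts (insert f G) m = missedVerts (insert e G) m :=
    Set.eq_of_subset_of_ncard_le h1 (by omega)
  refine ⟨hfG, h4, fun g => ?_⟩
  have he : IsUseless (insert f G) m e := by
    rw [IsUseless, Set.insert_comm, h4]
    exact hfe
  rw [← hfG.isUseless_insert_iff he, Set.insert_comm, heG.isUseless_insert_iff hfe]

end Closure

/-! ### Rainbow matchings and edges chosen from unused colours -/

/-- `c` colours the edges of the matching `M` injectively by members of the family `E`. -/
def IsRainbowColoring {V ι : Type*} (E : ι → Set (Sym2 V)) (M : Finset (Sym2 V))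
    (c : Sym2 V → ι) : Prop :=
  IsFinMatching M ∧ Set.InjOn c M ∧ ∀ e ∈ M, e ∈ E (c e)

/-- The edges of `M` together with the edges chosen by `h` from the colours in `T`. -/
def withChoices {V ι : Type*} (M : Finset (Sym2 V)) (T : Finset ι) (h : ι → Sym2 V) :
    Set (Sym2 V) := ↑M ∪ h '' ↑T

section Rainbow

variable {V ι : Type*} [DecidableEq V] [DecidableEq ι] {E : ι → Set (Sym2 V)}

theorem IsRainbowColoring.subset {V ι : Type*} {E : ι → Set (Sym2 V)} {M N : Finset (Sym2 V)}
    {c : Sym2 V → ι} (h : IsRainbowColoring E M c) (hN : N ⊆ M) : IsRainbowColoring E N c :=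
  ⟨h.1.subset hN, h.2.1.mono (Finset.coe_subset.2 hN), fun e he => h.2.2 e (hN he)⟩

theorem IsRainbowColoring.insert_edge {M : Finset (Sym2 V)} {c : Sym2 V → ι}
    (h : IsRainbowColoring E M c) {j : ι} (hj : j ∉ M.image c) {u v : V} (huv : u ≠ v)
    (hf : s(u, v) ∈ E j) (hu : u ∉ coveredVerts M) (hv : v ∉ coveredVerts M) :
    IsRainbowColoring E (insert s(u, v) M) (Function.update c s(u, v) j) := by
  have hfM : s(u, v) ∉ M := fun h => hu (left_mem_coveredVerts h)
  have key : ∀ e ∈ M, Function.update c s(u, v) j e = c e := by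
    intro e he
    refine Function.update_of_ne ?_ _ _
    rintro rfl
    exact hfM he
  have hjc : ∀ e ∈ M, c e ≠ j := fun e he h => hj (Finset.mem_image.2 ⟨e, he, h⟩)
  refine ⟨h.1.insert_edge huv hu hv, ?_, ?_⟩
  · intro e he f hf hef
    rcases Finset.mem_insert.1 he with rfl | he <;> rcases Finset.mem_insert.1 hf with rfl | hf
    · rfl
    · rw [key f hf, Function.update_self] at hef
      exact (hjc f hf hef.symm).elim
    · rw [key e he, Function.update_self] at hef
      exact (hjc e he hef).elim
    · rw [key e he, key f hf] at hef
      exact h.2.1 he hf hef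
  · intro e he
    rcases Finset.mem_insert.1 he with rfl | he
    · rwa [Function.update_self]
    · rw [key e he]
      exact h.2.2 e he

/-- Edges of `M` keep their colours and every other edge takes a colour of `T` that chose it. The
bound on the colours used keeps all remaining colours available for augmentation. -/
theorem IsRainbowColoring.exists_of_withChoices {M : Finset (Sym2 V)} {c : Sym2 V → ι}
    (hM : IsRainbowColoring E M c) {T : Finset ι} (hT : Disjoint T (M.image c)) {h : ι → Sym2 V}
    (hh : ∀ i ∈ T, h i ∈ E i) {N : Finset (Sym2 V)} (hN : IsFinMatching N)
    (hNs : (N : Set (Sym2 V)) ⊆ withChoices M T h) :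
    ∃ c', IsRainbowColoring E N c' ∧ N.image c' ⊆ M.image c ∪ T := by
  have : ∀ e, ∃ i, (e ∈ M → i = c e) ∧ (e ∈ N → e ∉ M → i ∈ T ∧ h i = e) := by
    intro e
    by_cases he : e ∈ M
    · exact ⟨c e, fun _ => rfl, fun _ h => (h he).elim⟩
    · by_cases heN : e ∈ N
      · obtain ⟨i, hi, rfl⟩ := (hNs heN).resolve_left he
        exact ⟨i, fun h => (he h).elim, fun _ _ => ⟨hi, rfl⟩⟩
      · exact ⟨c e, fun h => (he h).elim, fun h => (heN h).elim⟩
  choose c' h1 h2 using this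
  refine ⟨c', ⟨hN, ?_, ?_⟩, ?_⟩
  · intro e he f hf hef
    by_cases heM : e ∈ M <;> by_cases hfM : f ∈ M
    · rw [h1 e heM, h1 f hfM] at hef
      exact hM.2.1 heM hfM hef
    · have := (h2 f hf hfM).1
      rw [← hef, h1 e heM] at this
      exact (Finset.disjoint_left.1 hT this (Finset.mem_image_of_mem c heM)).elim
    · have := (h2 e he heM).1
      rw [hef, h1 f hfM] at this
      exact (Finset.disjoint_left.1 hT this (Finset.mem_image_of_mem c hfM)).elim
    · rw [← (h2 e he heM).2, ← (h2 f hf hfM).2, hef]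
  · intro e he
    by_cases heM : e ∈ M
    · rw [h1 e heM]; exact hM.2.2 e heM
    · have := h2 e he heM
      have h3 := hh _ this.1
      rwa [this.2] at h3
  · intro i hi
    obtain ⟨e, he, rfl⟩ := Finset.mem_image.1 hi
    by_cases heM : e ∈ M
    · rw [h1 e heM]; exact Finset.mem_union_left _ (Finset.mem_image_of_mem c heM)
    · exact Finset.mem_union_right _ (h2 e he heM).1

theorem IsRainbowColoring.hasMatchingNumber_withChoices {M : Finset (Sym2 V)} {c : Sym2 V → ι}
    (hM : IsRainbowColoring E M c)
    (hno : ∀ N c', IsRainbowColoring E N c' → N.card ≠ M.card + 1) {T : Finset ι}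
    (hT : Disjoint T (M.image c)) {h : ι → Sym2 V} (hh : ∀ i ∈ T, h i ∈ E i) :
    HasMatchingNumber (withChoices M T h) M.card := by
  refine ⟨⟨M, hM.1, Set.subset_union_left, rfl⟩, fun N hN hs => ?_⟩
  by_contra hc
  obtain ⟨N', hN', hcard⟩ := Finset.exists_subset_card_eq (show M.card + 1 ≤ N.card by omega)
  obtain ⟨c', hc', -⟩ := hM.exists_of_withChoices hT hh hN hs
  exact hno N' c' (hc'.subset hN') hcard

theorem withChoices_insert {V ι : Type*} [DecidableEq ι] {M : Finset (Sym2 V)} {T : Finset ι}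
    {h : ι → Sym2 V} {i : ι} (hi : i ∉ T) (e : Sym2 V) :
    withChoices M (insert i T) (Function.update h i e) = insert e (withChoices M T h) := by
  unfold withChoices
  rw [Finset.coe_insert, Set.image_insert_eq, Function.update_self, Set.union_insert]
  congr 2
  refine Set.image_congr fun x hx => Function.update_of_ne ?_ _ _
  rintro rfl
  exact hi hx

theorem update_choice_mem {V ι : Type*} [DecidableEq ι] {E : ι → Set (Sym2 V)} {T : Finset ι}
    {h : ι → Sym2 V} (hh : ∀ i ∈ T, h i ∈ E i) {i : ι} {e : Sym2 V} (he : e ∈ E i) :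
    ∀ l ∈ insert i T, Function.update h i e l ∈ E l := by
  intro l hl
  by_cases hli : l = i
  · subst hli; rwa [Function.update_self]
  · rw [Function.update_of_ne hli]
    exact hh l ((Finset.mem_insert.1 hl).resolve_left hli)

variable [Fintype V]

theorem ncard_missedVerts_le (G : Set (Sym2 V)) (m : ℕ) :
    (missedVerts G m).ncard ≤ Fintype.card V := by
  rw [← Nat.card_eq_fintype_card]
  exact Set.ncard_le_card _

/-- The number of missed vertices is the potential that bounds how many useful edges can be spent.
-/
theorem HasMatchingNumber.ncard_lt_of_not_isUseless {G : Set (Sym2 V)} {m : ℕ} {e : Sym2 V}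
    (h : HasMatchingNumber (insert e G) m) (he : ¬ IsUseless G m e) :
    (missedVerts G m).ncard < (missedVerts (insert e G) m).ncard :=
  Set.ncard_lt_ncard ((missedVerts_mono (Set.subset_insert _ _) m).ssubset_of_ne
    fun h' => he ⟨h, h'.symm⟩)

/-- At most one member of the family consists of useless edges only. -/
theorem HasMatchingNumber.eq_of_forall_isUseless {G : Set (Sym2 V)} {m : ℕ}
    (hG : HasMatchingNumber G m)
    (hE : ∀ i j, i ≠ j → ∃ N : Finset (Sym2 V), IsFinMatching N ∧
      (N : Set (Sym2 V)) ⊆ E i ∪ E j ∧ m + 1 ≤ N.card) {i j : ι}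
    (hi : ∀ e ∈ E i, IsUseless G m e) (hj : ∀ e ∈ E j, IsUseless G m e) : i = j := by
  by_contra hij
  obtain ⟨N, hN, hs, hc⟩ := hE i j hij
  have := (hG.card_le_of_isUseless hN fun e he => (hs he).elim (hi e) (hj e)).1
  omega

variable [Fintype ι]

theorem IsRainbowColoring.card_compl_image {V ι : Type*} [DecidableEq ι] [Fintype ι]
    {E : ι → Set (Sym2 V)} {M : Finset (Sym2 V)} {c : Sym2 V → ι}
    (hM : IsRainbowColoring E M c) :
    (M.image c)ᶜ.card + M.card = Fintype.card ι := by
  have h1 := Finset.card_add_card_compl (M.image c)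
  rw [Finset.card_image_of_injOn hM.2.1] at h1
  omega

/-! ### Spending unused colours -/

/-- Once more vertices are missed than colours have been spent, an augmentation is unavoidable. -/
theorem IsRainbowColoring.false_of_slack {M : Finset (Sym2 V)} {c : Sym2 V → ι}
    (hM : IsRainbowColoring E M c)
    (hno : ∀ N c', IsRainbowColoring E N c' → N.card ≠ M.card + 1)
    (hcard : 3 * M.card + 1 ≤ Fintype.card ι)
    (hE : ∀ i j, i ≠ j → ∃ N : Finset (Sym2 V), IsFinMatching N ∧
      (N : Set (Sym2 V)) ⊆ E i ∪ E j ∧ M.card + 1 ≤ N.card)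
    {T : Finset ι} (hT : Disjoint T (M.image c)) {h : ι → Sym2 V} (hh : ∀ i ∈ T, h i ∈ E i)
    (hD : Fintype.card V + T.card + 1 ≤
      (missedVerts (withChoices M T h) M.card).ncard + 2 * M.card) : False := by
  induction hn : 2 * M.card - T.card using Nat.strong_induction_on generalizing T h with
  | _ n ih =>
  have hG := hM.hasMatchingNumber_withChoices hno hT hh
  have hle := ncard_missedVerts_le (withChoices M T h) M.card
  have hcU := hM.card_compl_image
  have hsub : T ⊆ (M.image c)ᶜ := fun i hi => Finset.mem_compl.2 (Finset.disjoint_left.1 hT hi)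
  -- At most n vertices are missed, so `hD` gives |T| ≤ 2m - 1, while at least 2m + 1 colours are
  -- unused by `M`. Of two unspent colours, one has a useful edge, and spending it preserves the
  -- slack.
  have h2 : 1 < ((M.image c)ᶜ \ T).card := by
    rw [Finset.card_sdiff_of_subset hsub]
    omega
  obtain ⟨i, hi, j, hj, hij⟩ := Finset.one_lt_card.1 h2
  obtain ⟨l, hl, hlE⟩ : ∃ l ∈ (M.image c)ᶜ \ T,
      ¬ ∀ e ∈ E l, IsUseless (withChoices M T h) M.card e := by
    by_contra hc
    push Not at hc
    exact hij (hG.eq_of_forall_isUseless hE (hc i hi) (hc j hj))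
  push Not at hlE
  obtain ⟨e, he, heu⟩ := hlE
  rw [Finset.mem_sdiff, Finset.mem_compl] at hl
  have hT' : Disjoint (insert l T) (M.image c) := Finset.disjoint_insert_left.2 ⟨hl.1, hT⟩
  have hh' := update_choice_mem hh he
  have hG' := hM.hasMatchingNumber_withChoices hno hT' hh'
  rw [withChoices_insert hl.2] at hG'
  have hlt := hG'.ncard_lt_of_not_isUseless heu
  have hc' := Finset.card_insert_of_notMem hl.2
  exact ih _ (by omega) hT' hh' (by rw [withChoices_insert hl.2]; omega) rfl

/-- If every colour of a pool of unused colours has a useful edge, then the colours of the pool can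
be spent one by one, each adding a vertex missed by some maximum matching. -/
theorem IsRainbowColoring.exists_choices {M : Finset (Sym2 V)} {c : Sym2 V → ι}
    (hM : IsRainbowColoring E M c) (hne : ∀ i, (E i).Nonempty)
    (hno : ∀ N c', IsRainbowColoring E N c' → N.card ≠ M.card + 1)
    (hcard : 3 * M.card + 1 ≤ Fintype.card ι)
    (hE : ∀ i j, i ≠ j → ∃ N : Finset (Sym2 V), IsFinMatching N ∧
      (N : Set (Sym2 V)) ⊆ E i ∪ E j ∧ M.card + 1 ≤ N.card)
    {U : Finset ι} (hU : Disjoint U (M.image c))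
    (hUE : ∀ i ∈ U, ∃ e ∈ E i, ¬ IsUseless (M : Set (Sym2 V)) M.card e) :
    ∀ p ≤ U.card, ∃ T ⊆ U, T.card = p ∧ ∃ h : ι → Sym2 V, (∀ i ∈ T, h i ∈ E i) ∧
      Fintype.card V + p ≤ (missedVerts (withChoices M T h) M.card).ncard + 2 * M.card ∧
      ∀ i ∈ U, i ∉ T → ∃ e ∈ E i, ¬ IsUseless (withChoices M T h) M.card e := by
  intro p
  induction p with
  | zero =>
    intro _
    have h0 : ∀ h : ι → Sym2 V, withChoices M ∅ h = M := fun h => by simp [withChoices]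
    refine ⟨∅, by simp, rfl, fun i => (hne i).some, by simp, ?_, ?_⟩
    · rw [h0]
      have h1 : (((coveredVerts M)ᶜ : Finset V) : Set V) ⊆ missedVerts (M : Set (Sym2 V)) M.card :=
        fun v hv => ⟨M, ⟨hM.1, subset_rfl, rfl⟩, by simpa using hv⟩
      have h2 := Set.ncard_le_ncard h1
      rw [Set.ncard_coe_finset] at h2
      have h3 := Finset.card_add_card_compl (coveredVerts M)
      rw [hM.1.card_coveredVerts] at h3
      omega
    · rw [h0]
      exact fun i hi _ => hUE i hi
  | succ p ih =>
    intro hp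
    obtain ⟨T, hTU, hTp, h, hh, hD, hgood⟩ := ih (by omega)
    have hT : Disjoint T (M.image c) := Finset.disjoint_of_subset_left hTU hU
    have hG := hM.hasMatchingNumber_withChoices hno hT hh
    obtain ⟨i, hiU, hiT⟩ : ∃ i ∈ U, i ∉ T := by
      by_contra hc
      push Not at hc
      have := Finset.card_le_card (show U ⊆ T from hc)
      omega
    obtain ⟨e, he, heu⟩ := hgood i hiU hiT
    have step : ∀ l ∈ U, l ∉ T → ∀ f ∈ E l, insert l T ⊆ U ∧ (insert l T).card = p + 1 ∧
        (∀ x ∈ insert l T, Function.update h l f x ∈ E x) ∧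
        HasMatchingNumber (insert f (withChoices M T h)) M.card := by
      intro l hlU hlT f hf
      have hs := Finset.insert_subset hlU hTU
      refine ⟨hs, by rw [Finset.card_insert_of_notMem hlT, hTp], update_choice_mem hh hf, ?_⟩
      have := hM.hasMatchingNumber_withChoices hno (Finset.disjoint_of_subset_left hs hU)
        (update_choice_mem hh hf)
      rwa [withChoices_insert hlT] at this
    obtain ⟨s1, s2, s3, s4⟩ := step i hiU hiT e he
    have hlt := s4.ncard_lt_of_not_isUseless heu
    by_cases hbad : ∃ l ∈ U, l ∉ insert i T ∧
        ∀ f ∈ E l, IsUseless (insert e (withChoices M T h)) M.card f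
    · obtain ⟨l, hlU, hlT, hl⟩ := hbad
      rw [Finset.mem_insert, not_or] at hlT
      obtain ⟨f, hf, hfu⟩ := hgood l hlU hlT.2
      have hle : (missedVerts (insert e (withChoices M T h)) M.card).ncard ≤
          (missedVerts (withChoices M T h) M.card).ncard + 1 := by
        by_contra hc
        refine hM.false_of_slack hno hcard hE (Finset.disjoint_of_subset_left s1 hU) s3 ?_
        rw [withChoices_insert hiT]
        omega
      obtain ⟨w1, w2, w3⟩ := hG.swap s4 hle hfu (hl f hf)
      obtain ⟨t1, t2, t3, -⟩ := step l hlU hlT.2 f hf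
      refine ⟨_, t1, t2, _, t3, ?_, fun x hxU hxT => ?_⟩
      · rw [withChoices_insert hlT.2, w2]
        omega
      · rw [withChoices_insert hlT.2]
        by_contra hc
        push Not at hc
        -- After the swap the useless edges are those after adding `e`, for which `l` is the only
        -- colour useless throughout; and `l` has just been spent.
        have hx : x = l := s4.eq_of_forall_isUseless hE
          (fun g hg => (w3 g).1 (hc g hg)) hl
        exact hxT (hx ▸ Finset.mem_insert_self _ _)
    · push Not at hbad
      refine ⟨_, s1, s2, _, s3, ?_, fun x hxU hxT => ?_⟩
      · rw [withChoices_insert hiT]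
        omega
      · rw [withChoices_insert hiT]
        exact hbad x hxU hxT

/-! ### Colours inside the covered set, and augmentation -/

/-- An edge whose addition to a matching `M` is useless joins vertices covered by `M`. -/
theorem IsFinMatching.mem_coveredVerts_of_isUseless {V : Type*} [DecidableEq V]
    {M : Finset (Sym2 V)} (hM : IsFinMatching M)
    {e : Sym2 V} (hd : ¬ e.IsDiag) (he : IsUseless (M : Set (Sym2 V)) M.card e) :
    ∀ v ∈ e, v ∈ coveredVerts M := by
  intro v hv
  by_contra hvM
  obtain ⟨u, rfl⟩ := Sym2.mem_iff_exists.1 hv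
  have hvu : v ≠ u := by simpa using hd
  by_cases hu : u ∈ coveredVerts M
  · obtain ⟨w, huw⟩ := exists_edge_of_mem_coveredVerts hu
    have e' := fun x => hM.coveredVerts_erase (x := x) huw
    -- Exchanging uw for vu frees w, yet `M` is its own only maximum matching and covers w.
    have hw : w ∈ missedVerts (insert s(v, u) (M : Set (Sym2 V))) M.card := by
      refine ⟨insert s(v, u) (M.erase s(u, w)), ⟨?_, ?_, ?_⟩, ?_⟩
      · exact (hM.subset (Finset.erase_subset _ _)).insert_edge hvu (by simp [e', hvM])
          (by simp [e'])
      · rw [Finset.coe_insert]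
        exact Set.insert_subset_insert (Finset.coe_subset.2 (Finset.erase_subset _ _))
      · rw [card_insert_edge (by simp [e', hvM]), Finset.card_erase_add_one huw]
      · have hwv : w ≠ v := by rintro rfl; exact hvM (right_mem_coveredVerts huw)
        simp [coveredVerts_insert, e', hwv, (hM.ne huw).symm]
    rw [he.2] at hw
    obtain ⟨N, hN, hwN⟩ := hw
    have : N = M := Finset.eq_of_subset_of_card_le (Finset.coe_subset.1 hN.2.1) hN.2.2.ge
    exact hwN (this ▸ right_mem_coveredVerts huw)
  · have := he.1.2 _ (hM.insert_edge hvu hvM hu) (by rw [Finset.coe_insert])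
    rw [card_insert_edge hvM] at this
    omega

/-- If a maximum rainbow matching `M` has size `m` and there are at least `3 * m + 1` colours,
then some unused colour has all its edges among the vertices covered by `M`. -/
theorem IsRainbowColoring.exists_unused {M : Finset (Sym2 V)} {c : Sym2 V → ι}
    (hM : IsRainbowColoring E M c) (hne : ∀ i, (E i).Nonempty)
    (hno : ∀ N c', IsRainbowColoring E N c' → N.card ≠ M.card + 1)
    (hcard : 3 * M.card + 1 ≤ Fintype.card ι)
    (hE : ∀ i j, i ≠ j → ∃ N : Finset (Sym2 V), IsFinMatching N ∧
      (N : Set (Sym2 V)) ⊆ E i ∪ E j ∧ M.card + 1 ≤ N.card) :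
    ∃ j ∉ M.image c, ∀ e ∈ E j, IsUseless (M : Set (Sym2 V)) M.card e := by
  by_contra hc
  push Not at hc
  have hcU := hM.card_compl_image
  obtain ⟨T, hTU, hTp, h, hh, hD, -⟩ := hM.exists_choices hne hno hcard hE
    (U := (M.image c)ᶜ) disjoint_compl_left
    -- With 2m + 1 colours spent, n + 1 vertices would be missed.
    (fun i hi => hc i (Finset.mem_compl.1 hi)) (2 * M.card + 1) (by omega)
  have := ncard_missedVerts_le (withChoices M T h) M.card
  omega

/-- A rainbow matching of size `m` can be replaced by a larger one if there are at least
`3 * m + 1` nonempty colours, any two of which contain a matching of size `m + 1`. -/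
theorem IsRainbowColoring.exists_larger {M : Finset (Sym2 V)} {c : Sym2 V → ι}
    (hM : IsRainbowColoring E M c) (hd : ∀ i, ∀ e ∈ E i, ¬ e.IsDiag) (hne : ∀ i, (E i).Nonempty)
    (hcard : 3 * M.card + 1 ≤ Fintype.card ι)
    (hE : ∀ i j, i ≠ j → ∃ N : Finset (Sym2 V), IsFinMatching N ∧
      (N : Set (Sym2 V)) ⊆ E i ∪ E j ∧ M.card + 1 ≤ N.card) :
    ∃ N c', IsRainbowColoring E N c' ∧ N.card = M.card + 1 := by
  by_contra hno
  push Not at hno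
  obtain ⟨j, hjM, hj⟩ := hM.exists_unused hne hno hcard hE
  have hMnum : HasMatchingNumber (M : Set (Sym2 V)) M.card :=
    ⟨⟨M, hM.1, subset_rfl, rfl⟩, fun N _ hs => Finset.card_le_card (Finset.coe_subset.1 hs)⟩
  have hcU := hM.card_compl_image
  have hU : Disjoint ((M.image c)ᶜ.erase j) (M.image c) :=
    Finset.disjoint_of_subset_left (Finset.erase_subset _ _) disjoint_compl_left
  obtain ⟨T, hTU, hTp, h, hh, hD, -⟩ := hM.exists_choices hne hno hcard hE hU (by
    intro i hi
    by_contra hc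
    push Not at hc
    exact (Finset.mem_erase.1 hi).1 (hMnum.eq_of_forall_isUseless hE hc hj))
    (2 * M.card) (by rw [Finset.card_erase_of_mem (Finset.mem_compl.2 hjM)]; omega)
  have hT : Disjoint T (M.image c) := Finset.disjoint_of_subset_left hTU hU
  have hjT : j ∉ T := fun h => (Finset.mem_erase.1 (hTU h)).1 rfl
  have hG := hM.hasMatchingNumber_withChoices hno hT hh
  have hall : missedVerts (withChoices M T h) M.card = Set.univ :=
    Set.eq_of_subset_of_ncard_le (Set.subset_univ _)
      (by rw [Set.ncard_univ, Nat.card_eq_fintype_card]; omega)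
  obtain ⟨f, hf⟩ := hne j
  have hjM' : ∀ e ∈ E j, ∀ v ∈ e, v ∈ coveredVerts M := fun e he =>
    hM.1.mem_coveredVerts_of_isUseless (hd j e he) (hj e he)
  induction f with | _ a b =>
  have hab : a ≠ b := by simpa using hd j _ hf
  have haM : a ∈ coveredVerts M := hjM' _ hf a (by simp)
  obtain ⟨N, hN, haN⟩ : a ∈ missedVerts (withChoices M T h) M.card := hall ▸ Set.mem_univ a
  obtain ⟨w, A, B, hwa, hA, hB, hAs, hBs, H⟩ := hM.1.exchange hN.1 haM haN
  have hsub : ((M ∪ N : Finset (Sym2 V)) : Set (Sym2 V)) ⊆ withChoices M T h := by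
    rw [Finset.coe_union]
    exact Set.union_subset Set.subset_union_left hN.2.1
  have hAG := (Finset.coe_subset.2 hAs).trans hsub
  rcases H with ⟨hw1, hw2, hAx, hBx, hAc, hBc⟩ | ⟨hw1, hw2, hAx, hBx, hAc, hBc⟩
  swap
  · have := hG.2 B hB ((Finset.coe_subset.2 hBs).trans hsub)
    have := hN.2.2
    omega
  have haA : a ∉ coveredVerts A := by simp [hAx, hwa.symm]
  obtain ⟨c', hc', hc'T⟩ := hM.exists_of_withChoices hT hh hA hAG
  have hjA : j ∉ A.image c' := fun h =>
    (Finset.mem_union.1 (hc'T h)).elim hjM hjT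
  by_cases hbA : b ∈ coveredVerts A
  swap
  · refine hno _ _ (hc'.insert_edge hjA hab hf haA hbA) ?_
    rw [card_insert_edge haA, hAc]
  obtain ⟨d, hbd⟩ := exists_edge_of_mem_coveredVerts hbA
  have e' := fun x => hA.coveredVerts_erase (x := x) hbd
  have haA' : a ∉ coveredVerts (A.erase s(b, d)) := by simp [e', haA]
  have hcardM' : (insert s(a, b) (A.erase s(b, d))).card = M.card := by
    rw [card_insert_edge haA', Finset.card_erase_add_one hbd, hAc]
  have hM' := (hc'.subset (Finset.erase_subset s(b, d) A)).insert_edge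
    (fun h => hjA (Finset.image_subset_image (Finset.erase_subset _ _) h)) hab hf haA'
    (by simp [e'])
  obtain ⟨j', hj'M, hj'⟩ := hM'.exists_unused hne (by rwa [hcardM']) (by rwa [hcardM'])
    (by rwa [hcardM'])
  have hjj' : j ≠ j' := by
    rintro rfl
    exact hj'M (Finset.mem_image.2 ⟨s(a, b), Finset.mem_insert_self _ _, Function.update_self ..⟩)
  have hj'' : ∀ e ∈ E j', ∀ v ∈ e, v ∈ insert w (coveredVerts M) := by
    intro e he v hv
    have := hM'.1.mem_coveredVerts_of_isUseless (hd j' e he) (hj' e he) v hv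
    rw [coveredVerts_insert, e', hAx] at this
    rw [Finset.mem_insert]
    rcases this with rfl | rfl | ⟨⟨h, -⟩ | h, -⟩
    · exact Or.inr haM
    · exact Or.inr (hjM' _ hf v (by simp))
    · exact Or.inr h
    · exact Or.inl h
  obtain ⟨Q, hQ, hQs, hQc⟩ := hE j j' hjj'
  -- `Q` has at least m + 1 edges but lives on at most 2m + 1 vertices.
  have h1 := hQ.two_mul_card_le (W := insert w (coveredVerts M)) fun e he v hv =>
    (hQs he).elim (fun h => Finset.mem_insert_of_mem (hjM' e h v hv)) fun h => hj'' e h v hv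
  have h2 := Finset.card_insert_le w (coveredVerts M)
  rw [hM.1.card_coveredVerts] at h2
  omega

end Rainbow

/-! ### Extended matching numbers and the theorem -/

theorem exists_finMatching_of_le_matchingNumber {V : Type*} [Finite V] {F : Set (Sym2 V)}
    (hF : ∀ e ∈ F, ¬ e.IsDiag) {k : ℕ} (h : ((k + 1 : ℕ) : ℕ∞) ≤ matchingNumber F) :
    ∃ N : Finset (Sym2 V), IsFinMatching N ∧ (N : Set (Sym2 V)) ⊆ F ∧ k + 1 ≤ N.card := by
  -- Lowering the bound to a strict one yields a matching beyond `k` without knowing that the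
  -- supremum is attained.
  have h1 : (k : ℕ∞) < matchingNumber F :=
    lt_of_lt_of_le (by exact_mod_cast Nat.lt_succ_self k) h
  unfold matchingNumber at h1
  obtain ⟨M, ⟨hMF, hM⟩, hk⟩ := lt_biSup_iff.1 h1
  have hfin := M.toFinite
  refine ⟨hfin.toFinset, ⟨fun e he => hF e (hMF (hfin.mem_toFinset.1 he)), ?_⟩, by simpa, ?_⟩
  · intro e he f hf v hve hvf
    by_contra hef
    exact hM (hfin.mem_toFinset.1 he) (hfin.mem_toFinset.1 hf) hef v hve hvf
  · rw [hfin.encard_eq_coe_toFinset_card] at hk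
    exact_mod_cast hk

theorem theorem4 {V : Type*} [Finite V] (G : SimpleGraph V) (k : ℕ) (hk : 1 ≤ k)
    (E : Fin (3 * k - 2) → Set (Sym2 V))
    (hEG : ∀ i, E i ⊆ G.edgeSet)
    (hne : ∀ i, (E i).Nonempty)
    (hE : ∀ i j, i ≠ j → (k : ℕ∞) ≤ matchingNumber (E i ∪ E j)) :
    ∃ M : Set (Sym2 V), IsRainbowMatching E M ∧ M.encard = k := by
  classical
  have := Fintype.ofFinite V
  have hd : ∀ i, ∀ e ∈ E i, ¬ e.IsDiag := fun i e he => G.not_isDiag_of_mem_edgeSet (hEG i he)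
  have key : ∀ m ≤ k, ∃ M c, IsRainbowColoring E M c ∧ M.card = m := by
    intro m
    induction m with
    | zero =>
      intro _
      -- A colour exists because k ≥ 1 gives 3k - 2 ≥ 1; on the empty matching its value is
      -- irrelevant.
      exact ⟨∅, fun _ => ⟨0, by omega⟩, ⟨⟨by simp, by simp⟩, by simp, by simp⟩, rfl⟩
    | succ m ih =>
      intro hm
      obtain ⟨M, c, hM, rfl⟩ := ih (by omega)
      refine hM.exists_larger hd hne (by rw [Fintype.card_fin]; omega) fun i j hij => ?_
      obtain ⟨N, hN, hs, hc⟩ := exists_finMatching_of_le_matchingNumber (k := k - 1)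
        (F := E i ∪ E j) (fun e he => he.elim (hd i e) (hd j e))
        (by rw [Nat.sub_add_cancel hk]; exact hE i j hij)
      exact ⟨N, hN, hs, by omega⟩
  obtain ⟨M, c, hM, hc⟩ := key k le_rfl
  refine ⟨M, ⟨fun e he f hf hef v hve hvf => hef (hM.1.2 e he f hf v hve hvf), fun e he =>
    Set.mem_iUnion.2 ⟨c e, hM.2.2 e he⟩, fun e => c e, ?_, fun e => hM.2.2 e e.2⟩, ?_⟩
  · intro e f hef
    exact Subtype.ext (hM.2.1 e.2 f.2 hef)
  · rw [Set.encard_coe_eq_coe_finsetCard, hc]
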